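/- Let $n\ge 3$. In the complex Hilbert space $L^2(\mathbb R^n)$, with scalar product $(u|v)=\int u\overline v\,dx$ and norm $\|\cdot\|$, put $\partial_r=\frac{x}{|x|}\cdot\nabla$ (taken in the sense of distributions on $\mathbb R^n\setminus\{0\}$, and defined on $\{\varphi\in L^2:\partial_r\varphi\in L^2\}$) and let $$A=-i\,\partial_r-i\,\frac{n-1}{2|x|},\quad D(A)=\Big\{\varphi\in L^2:\ \partial_r\varphi,\ \tfrac1{|x|}\varphi\in L^2\Big\},\qquad B=\frac1{|x|},\quad D(B)=\Big\{\varphi\in L^2:\ \tfrac1{|x|}\varphi\in L^2\Big\}.$$ For $\varphi,\psi\in D(A)\cap D(B)$ the commutator is the form $([A,B]\varphi|\psi)=(B\varphi|A\psi)-(A\varphi|B\psi)$. (i) Every $\varphi\in C_0^\infty(\mathbb R^n\setminus\{0\};\mathbb C)$ lies in $D(AB)\cap D(BA)\cap D(B^2)$, and $AB\varphi-BA\varphi=iB^2\varphi$. (ii) $H^1(\mathbb R^n)\subset D(A)\cap D(B)$, and if $\varphi\in H^1(\mathbb R^n)$ satisfies $A\varphi\ne0$ and $B\varphi\ne0$,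 then $$\|B\varphi\|^2=-i([A,B]\varphi|\varphi)=-2\,\mathrm{Im}\,(A\varphi|B\varphi)=\|A\varphi\|\,\|B\varphi\|\left(2-\left\|\frac{A\varphi}{\|A\varphi\|}+i\frac{B\varphi}{\|B\varphi\|}\right\|^2\right),$$ $$\|A\varphi\|^2=\|\partial_r\varphi\|^2-\frac{(n-1)(n-3)}4\|B\varphi\|^2.$$ (iii) For every $\varphi\in H^1(\mathbb R^n)$, $$\Big\|\frac1{|x|}\varphi\Big\|=\|B\varphi\|\le 2\|A\varphi\|=2\,\Big\|\partial_r\varphi+\frac{n-1}{2|x|}\varphi\Big\|,$$ $$4\|\partial_r\varphi\|^2=4\,\Big\|\partial_r\varphi+\frac{n-2}{2|x|}\varphi\Big\|^2+(n-2)^2\Big\|\frac1{|x|}\varphi\Big\|^2.$$ -/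

import Mathlib

open MeasureTheory
open scoped ContDiff

noncomputable section

namespace RadialHardy

/-- Euclidean space `ℝⁿ`. -/
abbrev E (n : ℕ) : Type := EuclideanSpace ℝ (Fin n)

/-- The complex Hilbert space `L²(ℝⁿ)` (Lebesgue measure). -/
abbrev L2 (n : ℕ) : Type := Lp ℂ 2 (volume : Measure (E n))

/-- The scalar product `(u|v)`, linear in the first and antilinear in the second variable. -/
def sp {H : Type*} [NormedAddCommGroup H] [InnerProductSpace ℂ H] (u v : H) : ℂ :=
  inner ℂ v u

/-- The commutator `[A, B]` of two operators with domains, as a sesquilinear form on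
`D(A) ∩ D(B)`: `([A, B]φ|ψ) = (Bφ|Aψ) - (Aφ|Bψ)`. -/
def commForm {H : Type*} [NormedAddCommGroup H] [InnerProductSpace ℂ H] (A B : H →ₗ.[ℂ] H)
    (φ ψ : (A.domain ⊓ B.domain : Submodule ℂ H)) : ℂ :=
  sp (B ⟨φ, φ.2.2⟩) (A ⟨ψ, ψ.2.1⟩) - sp (A ⟨φ, φ.2.1⟩) (B ⟨ψ, ψ.2.2⟩)

/-- The Sobolev space `H¹(ℝⁿ) = H^{1,2}(ℝⁿ)`. -/
def H1 (n : ℕ) : Set (L2 n) :=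
  {φ | TemperedDistribution.MemSobolev 1 2 (Lp.toTemperedDistribution φ)}

/-- Smooth, compactly supported functions on `ℝⁿ ∖ {0}`, with values in `F`
(extended by zero to `ℝⁿ`). -/
def IsTest {n : ℕ} {F : Type*} [NormedAddCommGroup F] [NormedSpace ℝ F] (η : E n → F) : Prop :=
  ContDiff ℝ ∞ η ∧ HasCompactSupport η ∧ tsupport η ⊆ {0}ᶜ

/-- The divergence `∇ · ((x/|x|) η) = ∑ⱼ ∂ⱼ ((xⱼ/|x|) η)`. -/
def radialDiv {n : ℕ} (η : E n → ℝ) (x : E n) : ℝ :=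
  ∑ j : Fin n, fderiv ℝ (fun y : E n => y j / ‖y‖ * η y) x (EuclideanSpace.single j 1)

/-- `g ∈ L²` is the distributional radial derivative `∂ᵣφ = (x/|x|) · ∇φ` of `φ ∈ L²` on
`ℝⁿ ∖ {0}`. -/
def HasWeakRadialDeriv {n : ℕ} (φ g : L2 n) : Prop :=
  ∀ η : E n → ℝ, IsTest η → ∫ x, radialDiv η x • φ x = -∫ x, η x • g x

theorem IsTest.contDiff_component {n : ℕ} {η : E n → ℝ} (h : IsTest η) (j : Fin n) :
    ContDiff ℝ ∞ (fun y : E n => y j / ‖y‖ * η y) := by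
  rw [contDiff_iff_contDiffAt]
  intro x
  by_cases hx : x ∈ tsupport η
  · have h0 : x ≠ 0 := fun h' => h.2.2 hx (by simp [h'])
    have h1 : ContDiffAt ℝ ∞ (fun y : E n => ‖y‖) x := contDiffAt_norm ℝ h0
    have h2 : ContDiffAt ℝ ∞ (fun y : E n => y j) x := by fun_prop
    exact (h2.div h1 (by simpa using h0)).mul h.1.contDiffAt
  · have : (fun y : E n => y j / ‖y‖ * η y) =ᶠ[nhds x] fun _ => 0 := by
      filter_upwards [notMem_tsupport_iff_eventuallyEq.mp hx] with y hy
      simp [hy]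
    exact contDiffAt_const.congr_of_eventuallyEq this

theorem IsTest.continuous_radialDiv {n : ℕ} {η : E n → ℝ} (h : IsTest η) :
    Continuous (radialDiv η) := by
  unfold radialDiv
  refine continuous_finsetSum _ fun j _ => ?_
  exact ((h.contDiff_component j).continuous_fderiv (by simp)).clm_apply continuous_const

theorem IsTest.hasCompactSupport_radialDiv {n : ℕ} {η : E n → ℝ} (h : IsTest η) :
    HasCompactSupport (radialDiv η) := by
  refine h.2.1.mono' ?_
  intro x hx
  by_contra hn
  apply hx
  unfold radialDiv
  refine Finset.sum_eq_zero fun j _ => ?_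
  have : (fun y : E n => y j / ‖y‖ * η y) =ᶠ[nhds x] fun _ => (0 : ℝ) := by
    filter_upwards [notMem_tsupport_iff_eventuallyEq.mp hn] with y hy
    simp [hy]
  rw [this.fderiv_eq]
  simp

theorem locallyIntegrable {n : ℕ} (φ : L2 n) : LocallyIntegrable φ volume :=
  (Lp.memLp φ).locallyIntegrable (by norm_num)

theorem integrable_test_smul {n : ℕ} {η : E n → ℝ} (h : IsTest η) (φ : L2 n) :
    Integrable (fun x => η x • φ x) volume :=
  (locallyIntegrable φ).integrable_smul_left_of_hasCompactSupport h.1.continuous h.2.1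

theorem integrable_radialDiv_smul {n : ℕ} {η : E n → ℝ} (h : IsTest η) (φ : L2 n) :
    Integrable (fun x => radialDiv η x • φ x) volume :=
  (locallyIntegrable φ).integrable_smul_left_of_hasCompactSupport h.continuous_radialDiv
    h.hasCompactSupport_radialDiv

/-- The graph `{(φ, ∂ᵣφ) : φ ∈ L², ∂ᵣφ ∈ L²}`. -/
def radialDerivGraph (n : ℕ) : Submodule ℂ (L2 n × L2 n) where
  carrier := {p | HasWeakRadialDeriv p.1 p.2}
  add_mem' := by
    intro p q hp hq η hη
    have e1 : ∫ x, radialDiv η x • (p.1 + q.1 : L2 n) x =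
        (∫ x, radialDiv η x • p.1 x) + ∫ x, radialDiv η x • q.1 x := by
      rw [← integral_add (integrable_radialDiv_smul hη _) (integrable_radialDiv_smul hη _)]
      refine integral_congr_ae ?_
      filter_upwards [Lp.coeFn_add p.1 q.1] with x hx
      rw [hx, Pi.add_apply, smul_add]
    have e2 : ∫ x, η x • (p.2 + q.2 : L2 n) x =
        (∫ x, η x • p.2 x) + ∫ x, η x • q.2 x := by
      rw [← integral_add (integrable_test_smul hη _) (integrable_test_smul hη _)]
      refine integral_congr_ae ?_
      filter_upwards [Lp.coeFn_add p.2 q.2] with x hx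
      rw [hx, Pi.add_apply, smul_add]
    rw [Prod.fst_add, Prod.snd_add, e1, e2, hp η hη, hq η hη]
    ring
  zero_mem' := by
    intro η hη
    have e (f : E n → ℝ) : ∫ x, f x • (0 : L2 n) x = 0 := by
      refine integral_eq_zero_of_ae ?_
      filter_upwards [Lp.coeFn_zero (E := ℂ) (p := 2) (μ := (volume : Measure (E n)))] with x hx
      rw [hx]
      simp
    rw [Prod.fst_zero, Prod.snd_zero, e, e, neg_zero]
  smul_mem' := by
    intro c p hp η hη
    have e (f : E n → ℝ) (u : L2 n) : ∫ x, f x • (c • u) x = c * ∫ x, f x • u x := by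
      rw [← integral_const_mul]
      refine integral_congr_ae ?_
      filter_upwards [Lp.coeFn_smul c u] with x hx
      simp only [hx, Pi.smul_apply, Complex.real_smul, smul_eq_mul]
      ring
    rw [Prod.smul_fst, Prod.smul_snd, e, e, hp η hη]
    ring

/-- The weak radial derivative is unique. -/
theorem radialDerivGraph_single_valued {n : ℕ} (hn : 1 ≤ n) (p : L2 n × L2 n)
    (hp : p ∈ radialDerivGraph n) (h0 : p.1 = 0) : p.2 = 0 := by
  have : Nonempty (Fin n) := ⟨⟨0, hn⟩⟩
  have key : ∀ᵐ x ∂(volume : Measure (E n)), x ∈ ({0}ᶜ : Set (E n)) → p.2 x = 0 := by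
    refine IsOpen.ae_eq_zero_of_integral_contDiff_smul_eq_zero isOpen_compl_singleton
      ((locallyIntegrable p.2).locallyIntegrableOn _) ?_
    intro η h1 h2 h3
    have h4 : ∫ x, radialDiv η x • p.1 x = -∫ x, η x • p.2 x := hp η ⟨h1, h2, h3⟩
    have h5 : ∫ x, radialDiv η x • p.1 x = 0 := by
      rw [h0]
      refine integral_eq_zero_of_ae ?_
      filter_upwards [Lp.coeFn_zero (E := ℂ) (p := 2) (μ := (volume : Measure (E n)))] with x hx
      rw [hx]
      simp
    rw [h5] at h4
    exact neg_eq_zero.mp h4.symm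
  have hne : ∀ᵐ x ∂(volume : Measure (E n)), x ∈ ({0}ᶜ : Set (E n)) :=
    compl_mem_ae_iff.mpr (measure_singleton _)
  rw [Lp.eq_zero_iff_ae_eq_zero]
  filter_upwards [key, hne] with x h1 h2 using h1 h2

/-- The radial derivative `∂ᵣ = (x/|x|) · ∇` as an operator in `L²(ℝⁿ)`, with domain
`{φ ∈ L² : ∂ᵣφ ∈ L²}`. -/
def radialDeriv (n : ℕ) : L2 n →ₗ.[ℂ] L2 n := (radialDerivGraph n).toLinearPMap

/-- `∂ᵣφ = g` if and only if `g` is the distributional radial derivative of `φ`. -/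
theorem mem_graph_radialDeriv {n : ℕ} (hn : 1 ≤ n) (φ g : L2 n) :
    (φ, g) ∈ (radialDeriv n).graph ↔ HasWeakRadialDeriv φ g := by
  rw [radialDeriv, Submodule.toLinearPMap_graph_eq _ (radialDerivGraph_single_valued hn)]
  rfl

/-- The graph `{(φ, φ/|x|) : φ ∈ L², φ/|x| ∈ L²}`. -/
def coulombGraph (n : ℕ) : Submodule ℂ (L2 n × L2 n) where
  carrier := {p | ∀ᵐ x : E n, p.2 x = p.1 x / (‖x‖ : ℂ)}
  add_mem' := by
    intro p q hp hq
    filter_upwards [hp, hq, Lp.coeFn_add p.1 q.1, Lp.coeFn_add p.2 q.2] with x h1 h2 h3 h4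
    simp only [Prod.fst_add, Prod.snd_add, h3, h4, Pi.add_apply, h1, h2, add_div]
  zero_mem' := by
    filter_upwards [Lp.coeFn_zero (E := ℂ) (p := 2) (μ := (volume : Measure (E n)))] with x hx
    simp [hx]
  smul_mem' := by
    intro c p hp
    filter_upwards [hp, Lp.coeFn_smul c p.1, Lp.coeFn_smul c p.2] with x h1 h2 h3
    simp only [Prod.smul_fst, Prod.smul_snd, h2, h3, Pi.smul_apply, h1, smul_eq_mul, mul_div_assoc]

theorem coulombGraph_single_valued {n : ℕ} (p : L2 n × L2 n)
    (hp : p ∈ coulombGraph n) (h0 : p.1 = 0) : p.2 = 0 := by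
  rw [Lp.eq_zero_iff_ae_eq_zero]
  rw [Lp.eq_zero_iff_ae_eq_zero] at h0
  filter_upwards [hp, h0] with x h1 h2
  simp [h1, h2]

/-- The Coulomb potential `B = 1/|x|` as a multiplication operator in `L²(ℝⁿ)`, with domain
`{φ ∈ L² : φ/|x| ∈ L²}`. -/
def opB (n : ℕ) : L2 n →ₗ.[ℂ] L2 n := (coulombGraph n).toLinearPMap

/-- `Bφ = g` if and only if `g(x) = φ(x)/|x|` almost everywhere. -/
theorem mem_graph_opB {n : ℕ} (φ g : L2 n) :
    (φ, g) ∈ (opB n).graph ↔ ∀ᵐ x : E n, g x = φ x / (‖x‖ : ℂ) := by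
  rw [opB, Submodule.toLinearPMap_graph_eq _ coulombGraph_single_valued]
  rfl

/-- The symmetrized radial derivative `A = -i ∂ᵣ - i (n-1)/(2|x|)`, with domain
`{φ ∈ L² : ∂ᵣφ ∈ L², φ/|x| ∈ L²}` (a sum of operators has the intersection of the domains
as its domain). -/
def opA (n : ℕ) : L2 n →ₗ.[ℂ] L2 n :=
  (-Complex.I) • radialDeriv n + (-Complex.I * (((n : ℂ) - 1) / 2)) • opB n

end RadialHardy

end

noncomputable section

/-! On test functions the commutator is a pointwise computation: the potential part of `A` commutes
with `B`, and `-i[∂ᵣ, 1/|x|] = i/|x|²`. On `H¹` everything follows from the virial relation `(n -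
2)‖φ/|x|‖² = -2 Re (φ/|x|, ∂ᵣφ)`, the integrated form of `div (x/|x|²) = (n - 2)/|x|²`. Given it,
`hardy_identities` is Hilbert space algebra, in which `∂ᵣφ` and `φ/|x|` are just two vectors.

The field `x/|x|²` is singular, so integration by parts is done with `x/(|x|² + ε)` on Schwartz
functions (`integral_regDiv_schwartz`). For fixed `ε` all weights are bounded, so the identity is a
closed condition on pairs in `L² × L²` and passes to `H¹`, whose elements are limits of Schwartz
functions together with their radial derivatives (`exists_mem_closure_schwartzRadialGraph`). For `n
≥ 3` the regularized identity bounds the regularizations of `φ/|x|` by `2‖∂ᵣφ‖` uniformly in `ε`.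
Fatou's lemma then gives `φ/|x| ∈ L²` (`memLp_div_norm_of_mem_closure`), and dominated convergence
gives the virial relation (`virial_of_mem_closure`). -/

namespace RadialHardy

open scoped SchwartzMap LineDeriv FourierTransform Topology

/-! ### Multiplication operators and Fourier multipliers on `L²` -/

/-- Multiplication by a bounded function as a bounded operator on `L²`. -/
def mulL {n : ℕ} (m : Lp ℂ ⊤ (volume : Measure (E n))) : L2 n →L[ℂ] L2 n :=
  (ContinuousLinearMap.mul ℂ ℂ).holderL volume ⊤ 2 2 m

theorem mulL_ae {n : ℕ} (m : Lp ℂ ⊤ (volume : Measure (E n))) (f : L2 n) :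
    mulL m f =ᵐ[volume] fun x => m x * f x :=
  (ContinuousLinearMap.mul ℂ ℂ).coeFn_holder m f

theorem mulL_toLp_ae {n : ℕ} {m : E n → ℂ} (hm : MemLp m ⊤ volume) (f : L2 n) :
    mulL hm.toLp f =ᵐ[volume] fun x => m x * f x := by
  filter_upwards [mulL_ae hm.toLp f, hm.coeFn_toLp] with x h1 h2
  rw [h1, h2]

theorem toTemperedDistribution_injective {n : ℕ} :
    Function.Injective (Lp.toTemperedDistribution : L2 n → 𝓢'(E n, ℂ)) :=
  LinearMap.ker_eq_bot.mp (Lp.ker_toTemperedDistributionCLM_eq_bot (F := ℂ) (p := 2)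
    (μ := (volume : Measure (E n))))

/-- The Fourier multiplier with a bounded symbol, as a bounded operator on `L²`. -/
def multiplierL {n : ℕ} (m : Lp ℂ ⊤ (volume : Measure (E n))) : L2 n →L[ℂ] L2 n :=
  ((Lp.fourierTransformₗᵢ (E n) ℂ).symm.toContinuousLinearEquiv : L2 n →L[ℂ] L2 n) ∘L mulL m ∘L
    ((Lp.fourierTransformₗᵢ (E n) ℂ).toContinuousLinearEquiv : L2 n →L[ℂ] L2 n)

/-- The symbol plays two roles: boundedness makes it act on `L²`, temperate growth makes it act on
tempered distributions. -/
theorem multiplierL_toTemperedDistribution {n : ℕ} {m : E n → ℂ} (hm : MemLp m ⊤ volume)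
    (hg : m.HasTemperateGrowth) (f : L2 n) :
    (multiplierL hm.toLp f : 𝓢'(E n, ℂ)) =
      TemperedDistribution.fourierMultiplierCLM ℂ m (f : 𝓢'(E n, ℂ)) := by
  have h1 : multiplierL hm.toLp f = 𝓕⁻ (mulL hm.toLp (𝓕 f)) := rfl
  have h2 : mulL hm.toLp (𝓕 f) = (hm.toLp m • (𝓕 f) : L2 n) := by
    apply Lp.ext
    filter_upwards [mulL_ae hm.toLp (𝓕 f),
      Lp.coeFn_lpSMul (r := 2) (hm.toLp m) (𝓕 f)] with x h1 h2
    rw [h1, h2]; rfl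
  rw [h1, h2, ← Lp.fourierInv_toTemperedDistribution_eq, Lp.toTemperedDistribution_smul_eq hg,
    TemperedDistribution.fourierMultiplierCLM_apply, Lp.fourier_toTemperedDistribution_eq]

theorem multiplierL_toLp {n : ℕ} {m : E n → ℂ} (hm : MemLp m ⊤ volume)
    (hg : m.HasTemperateGrowth) (f : 𝓢(E n, ℂ)) :
    multiplierL hm.toLp (f.toLp 2) = (SchwartzMap.fourierMultiplierCLM ℂ m f).toLp 2 := by
  apply toTemperedDistribution_injective
  rw [multiplierL_toTemperedDistribution hm hg, Lp.toTemperedDistribution_toLp_eq,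
    TemperedDistribution.fourierMultiplierCLM_toTemperedDistributionCLM_eq hg,
    Lp.toTemperedDistribution_toLp_eq]

/-! ### Approximation of `H¹` by Schwartz functions through the Bessel potential -/

/-- The symbol of the Bessel potential of order `-1`. -/
def besselSymbol (n : ℕ) (x : E n) : ℂ := (((1 + ‖x‖ ^ 2) ^ (-1 / 2 : ℝ) : ℝ) : ℂ)

theorem hasTemperateGrowth_besselSymbol (n : ℕ) : (besselSymbol n).HasTemperateGrowth := by
  unfold besselSymbol
  fun_prop

theorem hasTemperateGrowth_inner_mul_besselSymbol {n : ℕ} (v : E n) :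
    (fun x => ((inner ℝ x v : ℝ) : ℂ) * besselSymbol n x).HasTemperateGrowth := by
  unfold besselSymbol
  fun_prop

theorem norm_besselSymbol {n : ℕ} (x : E n) :
    ‖besselSymbol n x‖ = (Real.sqrt (1 + ‖x‖ ^ 2))⁻¹ := by
  rw [besselSymbol, Complex.norm_real, Real.norm_of_nonneg (by positivity), Real.sqrt_eq_rpow,
    ← Real.rpow_neg (by positivity)]
  norm_num

theorem memLp_besselSymbol (n : ℕ) : MemLp (besselSymbol n) ⊤ volume := by
  refine memLp_top_of_bound
    (hasTemperateGrowth_besselSymbol n).1.continuous.aestronglyMeasurable 1 (.of_forall fun x => ?_)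
  rw [norm_besselSymbol]
  exact inv_le_one_of_one_le₀ (Real.one_le_sqrt.mpr (by nlinarith [sq_nonneg ‖x‖]))

/-- Up to the factor `2πi` this is the symbol of `∂ᵥ` composed with the Bessel potential of order
`-1`; it is bounded because `|x| ≤ √(1 + |x|²)`. -/
theorem memLp_inner_mul_besselSymbol {n : ℕ} (v : E n) :
    MemLp (fun x => ((inner ℝ x v : ℝ) : ℂ) * besselSymbol n x) ⊤ volume := by
  refine memLp_top_of_bound
    (hasTemperateGrowth_inner_mul_besselSymbol v).1.continuous.aestronglyMeasurable ‖v‖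
    (.of_forall fun x => ?_)
  rw [norm_mul, norm_besselSymbol, Complex.norm_real, Real.norm_eq_abs]
  have h0 : 0 < Real.sqrt (1 + ‖x‖ ^ 2) := Real.sqrt_pos.mpr (by positivity)
  have h1 : ‖x‖ ≤ Real.sqrt (1 + ‖x‖ ^ 2) := Real.le_sqrt_of_sq_le (by linarith)
  rw [← div_eq_mul_inv, div_le_iff₀ h0]
  calc |inner ℝ x v| ≤ ‖x‖ * ‖v‖ := abs_real_inner_le_norm x v
    _ ≤ ‖v‖ * Real.sqrt (1 + ‖x‖ ^ 2) := by
      rw [mul_comm]; gcongr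

/-- Every `φ ∈ H¹` is, together with its weak gradient, an `L²` limit of Schwartz functions. -/
theorem exists_mem_closure_of_mem_H1 {n : ℕ} {φ : L2 n} (hφ : φ ∈ H1 n) :
    ∃ g : Fin n → L2 n, (φ, g) ∈ closure (Set.range fun u : 𝓢(E n, ℂ) =>
      ((u.toLp 2 : L2 n), fun j : Fin n => ((∂_{EuclideanSpace.single j (1 : ℝ)} u).toLp 2 : L2 n))) := by
  obtain ⟨f, hf⟩ := hφ
  set e : Fin n → E n := fun j => EuclideanSpace.single j (1 : ℝ)
  -- `T` sends the `L²` function `(1 - Δ)^(1/2) φ` (up to normalization) to `φ` and its gradient. It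
  -- is continuous and maps Schwartz functions to Schwartz functions with their gradients, so
  -- density in `L²` suffices.
  let T : L2 n → L2 n × (Fin n → L2 n) := fun h =>
    (multiplierL (memLp_besselSymbol n).toLp h, fun j =>
      (2 * Real.pi * Complex.I : ℂ) • multiplierL (memLp_inner_mul_besselSymbol (e j)).toLp h)
  have hT : Continuous T := by fun_prop
  have hφ : φ = multiplierL (memLp_besselSymbol n).toLp f := by
    apply toTemperedDistribution_injective
    rw [multiplierL_toTemperedDistribution _ (hasTemperateGrowth_besselSymbol n), ← hf]
    have h : TemperedDistribution.besselPotential (E n) ℂ (-1)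
        (TemperedDistribution.besselPotential (E n) ℂ 1 (φ : 𝓢'(E n, ℂ))) = (φ : 𝓢'(E n, ℂ)) :=
      (TemperedDistribution.besselPotential_neg_apply_eq_iff _ _ _).2 rfl
    exact h.symm
  refine ⟨(T f).2, ?_⟩
  have hTf : (φ, (T f).2) = T f := by rw [hφ]
  rw [hTf]
  have hd : DenseRange (SchwartzMap.toLpCLM ℝ (E := E n) ℂ 2 volume) :=
    SchwartzMap.denseRange_toLpCLM ENNReal.ofNat_ne_top
  refine closure_mono ?_ (image_closure_subset_closure_image hT ⟨f, hd f, rfl⟩)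
  rintro _ ⟨_, ⟨u, rfl⟩, rfl⟩
  refine ⟨SchwartzMap.fourierMultiplierCLM ℂ (besselSymbol n) u, ?_⟩
  simp only [T, SchwartzMap.toLpCLM_apply]
  refine Prod.ext ?_ (funext fun j => ?_)
  · exact (multiplierL_toLp _ (hasTemperateGrowth_besselSymbol n) u).symm
  · simp only
    rw [multiplierL_toLp _ (hasTemperateGrowth_inner_mul_besselSymbol (e j)) u,
      SchwartzMap.lineDeriv_eq_fourierMultiplierCLM]
    have h1 : SchwartzMap.fourierMultiplierCLM ℂ (fun x : E n => inner ℝ x (e j))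
        (SchwartzMap.fourierMultiplierCLM ℂ (besselSymbol n) u) =
        SchwartzMap.fourierMultiplierCLM ℂ
          (fun x => ((inner ℝ x (e j) : ℝ) : ℂ) * besselSymbol n x) u := by
      rw [← SchwartzMap.fourierMultiplierCLM_ofReal ℂ (by fun_prop)]
      exact SchwartzMap.fourierMultiplierCLM_fourierMultiplierCLM_apply (by fun_prop)
        (hasTemperateGrowth_besselSymbol n) u
    rw [h1]
    rfl

/-! ### Classical and weak radial derivatives -/

theorem sum_coord_smul_map_single {n : ℕ} {F : Type*} [NormedAddCommGroup F] [NormedSpace ℝ F]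
    (T : E n →L[ℝ] F) (x : E n) : ∑ j, x j • T (EuclideanSpace.single j 1) = T x := by
  conv_rhs => rw [← (EuclideanSpace.basisFun (Fin n) ℝ).sum_repr x]
  simp [map_sum]

/-- The classical radial derivative `(x/|x|) · ∇f`. -/
def classicalRadial {n : ℕ} (f : E n → ℂ) (x : E n) : ℂ := fderiv ℝ f x (‖x‖⁻¹ • x)

theorem classicalRadial_eq_sum {n : ℕ} (f : E n → ℂ) (x : E n) :
    classicalRadial f x =
      ∑ j, (x j / ‖x‖) • fderiv ℝ f x (EuclideanSpace.single j 1) := by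
  rw [classicalRadial, ← sum_coord_smul_map_single]
  refine Finset.sum_congr rfl fun j _ => ?_
  simp [div_eq_inv_mul]

theorem IsTest.hasCompactSupport_component {n : ℕ} {η : E n → ℝ} (h : IsTest η) (j : Fin n) :
    HasCompactSupport (fun y : E n => y j / ‖y‖ * η y) := h.2.1.mul_left

/-- Integration by parts in each coordinate. The components `xⱼη/|x|` are smooth with compact
support, because `η` vanishes near the origin. -/
theorem IsTest.integral_radialDiv_smul {n : ℕ} {η : E n → ℝ} (hη : IsTest η) {u : E n → ℂ}
    (hu : ContDiff ℝ 1 u) :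
    ∫ x, radialDiv η x • u x = -∫ x, η x • classicalRadial u x := by
  have hd (j : Fin n) : Continuous fun x => fderiv ℝ u x (EuclideanSpace.single j 1) :=
    (hu.continuous_fderiv one_ne_zero).clm_apply continuous_const
  have hWc (j : Fin n) := (hη.contDiff_component j).continuous
  have hdW (j : Fin n) : Continuous fun x =>
      fderiv ℝ (fun y : E n => y j / ‖y‖ * η y) x (EuclideanSpace.single j 1) :=
    ((hη.contDiff_component j).continuous_fderiv (by simp)).clm_apply continuous_const
  have i1 (j : Fin n) : Integrable fun x =>
      fderiv ℝ (fun y : E n => y j / ‖y‖ * η y) x (EuclideanSpace.single j 1) • u x :=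
    ((hdW j).smul hu.continuous).integrable_of_hasCompactSupport
      (((hη.hasCompactSupport_component j).fderiv_apply ℝ _).smul_right)
  have i2 (j : Fin n) : Integrable fun x =>
      (x j / ‖x‖ * η x) • fderiv ℝ u x (EuclideanSpace.single j 1) :=
    ((hWc j).smul (hd j)).integrable_of_hasCompactSupport
      (hη.hasCompactSupport_component j).smul_right
  have i3 (j : Fin n) : Integrable fun x => (x j / ‖x‖ * η x) • u x :=
    ((hWc j).smul hu.continuous).integrable_of_hasCompactSupport
      (hη.hasCompactSupport_component j).smul_right
  have parts (j : Fin n) := integral_bilinear_fderiv_right_eq_neg_left_of_integrable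
    (B := ContinuousLinearMap.lsmul ℝ ℝ) (i1 j) (i2 j) (i3 j)
    (fun x _ => (hη.contDiff_component j).differentiable (by simp) x)
    (fun x _ => hu.differentiable one_ne_zero x)
  simp only [ContinuousLinearMap.lsmul_apply] at parts
  simp only [radialDiv, Finset.sum_smul]
  rw [integral_finsetSum _ fun j _ => i1 j]
  have e : (fun x => η x • classicalRadial u x) = fun x =>
      ∑ j, (x j / ‖x‖ * η x) • fderiv ℝ u x (EuclideanSpace.single j 1) := by
    ext x
    rw [classicalRadial_eq_sum, Finset.smul_sum]
    refine Finset.sum_congr rfl fun j _ => ?_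
    rw [smul_smul, mul_comm]
  rw [e, integral_finsetSum _ fun j _ => i2 j, ← Finset.sum_neg_distrib]
  exact Finset.sum_congr rfl fun j _ => by rw [parts j, neg_neg]

/-- The classical radial derivative of a `C¹` function is its weak radial derivative. -/
theorem hasWeakRadialDeriv_of_contDiff {n : ℕ} {φ g : L2 n} {u : E n → ℂ} (hu : ContDiff ℝ 1 u)
    (hφ : φ =ᵐ[volume] u) (hg : g =ᵐ[volume] classicalRadial u) : HasWeakRadialDeriv φ g := by
  intro η hη
  rw [integral_congr_ae (g := fun x => radialDiv η x • u x)
      (by filter_upwards [hφ] with x hx using by rw [hx]),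
    integral_congr_ae (f := fun x => η x • g x) (g := fun x => η x • classicalRadial u x)
      (by filter_upwards [hg] with x hx using by rw [hx])]
  exact hη.integral_radialDiv_smul hu

/-- The integral is an inner product with a fixed `L²` function. This is what makes the graph of the
weak radial derivative closed. -/
theorem continuous_integral_smul {n : ℕ} {w : E n → ℝ} (hw : Continuous w)
    (hc : HasCompactSupport w) : Continuous fun φ : L2 n => ∫ x, w x • φ x := by
  have hm : MemLp (fun x => (w x : ℂ)) 2 (volume : Measure (E n)) :=
    (Complex.continuous_ofReal.comp hw).memLp_of_hasCompactSupport
      (hc.comp_left (g := fun r : ℝ => (r : ℂ)) rfl)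
  have e : (fun φ : L2 n => ∫ x, w x • φ x) = fun φ : L2 n => inner ℂ hm.toLp φ := by
    ext φ
    rw [L2.inner_def]
    refine integral_congr_ae ?_
    filter_upwards [hm.coeFn_toLp] with x hx
    rw [hx]
    simp [mul_comm]
  rw [e]
  fun_prop

theorem isClosed_radialDerivGraph (n : ℕ) : IsClosed {p : L2 n × L2 n | HasWeakRadialDeriv p.1 p.2} := by
  simp only [HasWeakRadialDeriv, Set.ofPred_forall]
  refine isClosed_iInter fun η => isClosed_iInter fun hη => isClosed_eq ?_ ?_
  · exact (continuous_integral_smul hη.continuous_radialDiv hη.hasCompactSupport_radialDiv).comp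
      continuous_fst
  · exact ((continuous_integral_smul hη.1.continuous hη.2.1).comp continuous_snd).neg

/-- Schwartz functions together with their radial derivatives. -/
def schwartzRadialGraph (n : ℕ) : Set (L2 n × L2 n) :=
  {p | ∃ u : 𝓢(E n, ℂ), p.1 =ᵐ[volume] u ∧ p.2 =ᵐ[volume] classicalRadial u}

theorem memLp_coord_div_norm {n : ℕ} (j : Fin n) :
    MemLp (fun x : E n => ((x j / ‖x‖ : ℝ) : ℂ)) ⊤ volume := by
  have hm : Measurable fun x : E n => ((x j / ‖x‖ : ℝ) : ℂ) :=
    Complex.measurable_ofReal.comp (Measurable.div (by fun_prop) (by fun_prop))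
  refine memLp_top_of_bound hm.aestronglyMeasurable 1 (.of_forall fun x => ?_)
  rw [Complex.norm_real, norm_div, norm_norm]
  exact div_le_one_of_le₀ (PiLp.norm_apply_le x j) (norm_nonneg x)

/-- The coefficients `xⱼ/|x|` are bounded by `1`, so forming the radial part of a gradient is
continuous on `L²` and carries the approximation of the gradient over to `∂ᵣ`. -/
theorem exists_mem_closure_schwartzRadialGraph {n : ℕ} {φ : L2 n} (hφ : φ ∈ H1 n) :
    ∃ d : L2 n, (φ, d) ∈ closure (schwartzRadialGraph n) := by
  obtain ⟨g, hg⟩ := exists_mem_closure_of_mem_H1 hφ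
  let T : L2 n × (Fin n → L2 n) → L2 n × L2 n := fun p =>
    (p.1, ∑ j, mulL (memLp_coord_div_norm j).toLp (p.2 j))
  have hT : Continuous T := by fun_prop
  refine ⟨(T (φ, g)).2, closure_mono ?_ (image_closure_subset_closure_image hT ⟨_, hg, rfl⟩)⟩
  rintro _ ⟨_, ⟨u, rfl⟩, rfl⟩
  refine ⟨u, u.coeFn_toLp 2 volume, ?_⟩
  have h1 := Lp.coeFn_finsetSum (p := 2) (μ := (volume : Measure (E n))) Finset.univ
    fun j => mulL (memLp_coord_div_norm j).toLp
      ((∂_{EuclideanSpace.single j (1 : ℝ)} u).toLp 2 : L2 n)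
  have h2 : ∀ᵐ x ∂(volume : Measure (E n)), ∀ j, mulL (memLp_coord_div_norm j).toLp
      ((∂_{EuclideanSpace.single j (1 : ℝ)} u).toLp 2 : L2 n) x =
      ((x j / ‖x‖ : ℝ) : ℂ) * (∂_{EuclideanSpace.single j (1 : ℝ)} u) x := by
    rw [ae_all_iff]
    intro j
    filter_upwards [mulL_toLp_ae (memLp_coord_div_norm j)
      ((∂_{EuclideanSpace.single j (1 : ℝ)} u).toLp 2 : L2 n),
      (∂_{EuclideanSpace.single j (1 : ℝ)} u).coeFn_toLp 2 volume] with x h1 h2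
    rw [h1, h2]
  filter_upwards [h1, h2] with x h1 h2
  simp only [T]
  rw [h1, classicalRadial_eq_sum]
  simp only [Finset.sum_apply]
  refine Finset.sum_congr rfl fun j _ => ?_
  rw [h2 j, SchwartzMap.lineDerivOp_apply_eq_fderiv, Complex.real_smul]

theorem hasWeakRadialDeriv_of_mem_closure {n : ℕ} {φ d : L2 n}
    (h : (φ, d) ∈ closure (schwartzRadialGraph n)) : HasWeakRadialDeriv φ d := by
  refine closure_minimal ?_ (isClosed_radialDerivGraph n) h
  rintro ⟨φ, d⟩ ⟨u, h1, h2⟩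
  exact hasWeakRadialDeriv_of_contDiff (u.smooth 1) h1 h2

/-! ### Test functions -/

/-- Smoothness of `g` at the origin comes for free: `g` vanishes off `tsupport f`, a closed set that
misses the origin. -/
theorem IsTest.of_contDiffAt {n : ℕ} {f g : E n → ℂ} (hf : IsTest f)
    (hg : ∀ x, x ≠ 0 → ContDiffAt ℝ ∞ g x) (h0 : ∀ x, f =ᶠ[𝓝 x] 0 → g x = 0) : IsTest g := by
  have hs : tsupport g ⊆ tsupport f := by
    refine closure_minimal (fun x hx => ?_) (isClosed_tsupport f)
    by_contra hn
    exact hx (h0 x (notMem_tsupport_iff_eventuallyEq.mp hn))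
  refine ⟨contDiff_iff_contDiffAt.mpr fun x => ?_, hf.2.1.of_isClosed_subset (isClosed_tsupport g) hs,
    hs.trans hf.2.2⟩
  by_cases hx : x ∈ tsupport f
  · exact hg x (hf.2.2 hx)
  · exact contDiffAt_const.congr_of_eventuallyEq
      (notMem_tsupport_iff_eventuallyEq.mp fun h => hx (hs h))

theorem contDiffAt_ofReal_norm {n : ℕ} {x : E n} (hx : x ≠ 0) :
    ContDiffAt ℝ ∞ (fun y : E n => (‖y‖ : ℂ)) x :=
  Complex.ofRealCLM.contDiff.contDiffAt.comp x (contDiffAt_norm ℝ hx)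

theorem IsTest.div_norm {n : ℕ} {f : E n → ℂ} (hf : IsTest f) :
    IsTest fun x => f x / (‖x‖ : ℂ) := by
  refine hf.of_contDiffAt (fun x hx => ?_) fun x hx => by simp [hx.self_of_nhds]
  simp only [div_eq_mul_inv]
  exact hf.1.contDiffAt.mul ((contDiffAt_ofReal_norm hx).inv (by simpa using hx))

theorem IsTest.classicalRadial {n : ℕ} {f : E n → ℂ} (hf : IsTest f) :
    IsTest (classicalRadial f) := by
  refine hf.of_contDiffAt (fun x hx => ?_) fun x hx => ?_
  · have h1 : ContDiffAt ℝ ∞ (fun y : E n => ‖y‖⁻¹ • y) x :=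
      ((contDiffAt_norm ℝ hx).inv (by simpa using hx)).smul contDiffAt_id
    exact (hf.1.fderiv_right (m := ∞) (by simp)).contDiffAt.clm_apply h1
  · rw [RadialHardy.classicalRadial, hx.fderiv_eq]
    simp

theorem IsTest.const_mul_add {n : ℕ} {f g : E n → ℂ} (hf : IsTest f) (hg : IsTest g) (a b : ℂ) :
    IsTest fun x => a * f x + b * g x := by
  refine ⟨(contDiff_const.mul hf.1).add (contDiff_const.mul hg.1),
    hf.2.1.mul_left.add hg.2.1.mul_left, ?_⟩
  refine (tsupport_add _ _).trans (Set.union_subset ?_ ?_)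
  · exact (tsupport_mul_subset_right).trans hf.2.2
  · exact (tsupport_mul_subset_right).trans hg.2.2

theorem IsTest.memLp {n : ℕ} {f : E n → ℂ} (hf : IsTest f) : MemLp f 2 volume :=
  hf.1.continuous.memLp_of_hasCompactSupport hf.2.1

/-- The source of the commutator: `∂ᵣ(1/|x|) = -1/|x|²`, where Euler's identity for the norm,
homogeneous of degree one, gives `∂ᵣ|x| = 1`. -/
theorem IsTest.classicalRadial_div_norm {n : ℕ} {f : E n → ℂ} (hf : IsTest f) {x : E n}
    (hx : x ≠ 0) : RadialHardy.classicalRadial (fun y => f y / (‖y‖ : ℂ)) x =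
      RadialHardy.classicalRadial f x / ‖x‖ - f x / ‖x‖ / ‖x‖ := by
  have hx' : ‖x‖ ≠ 0 := norm_ne_zero_iff.mpr hx
  have hN : DifferentiableAt ℝ (fun y : E n => ‖y‖) x :=
    (contDiffAt_norm ℝ hx : ContDiffAt ℝ 1 _ x).differentiableAt one_ne_zero
  have hi : HasFDerivAt (fun y : E n => ‖y‖⁻¹) (-(‖x‖ ^ 2)⁻¹ • fderiv ℝ (fun y : E n => ‖y‖) x) x :=
    (hasDerivAt_inv hx').comp_hasFDerivAt x hN.hasFDerivAt
  have hF : HasFDerivAt (fun y => ‖y‖⁻¹ • f y) _ x :=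
    hi.smul (hf.1.differentiable (by simp) x).hasFDerivAt
  have e : (fun y => f y / (‖y‖ : ℂ)) = fun y => ‖y‖⁻¹ • f y := by
    ext y
    rw [Complex.real_smul, div_eq_inv_mul, Complex.ofReal_inv]
  rw [e, RadialHardy.classicalRadial, hF.fderiv]
  have hxc : (‖x‖ : ℂ) ≠ 0 := by exact_mod_cast hx'
  have hs : fderiv ℝ (fun y : E n => ‖y‖) x x = ‖x‖ := hN.fderiv_norm_self
  simp only [RadialHardy.classicalRadial, map_smul, add_apply,
    smul_apply, ContinuousLinearMap.smulRight_apply, hs, Complex.real_smul,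
    smul_eq_mul]
  push_cast
  field_simp
  ring

/-! ### Operator domains and the commutation relation on test functions -/

theorem exists_domain_of_hasWeakRadialDeriv {n : ℕ} (hn : 1 ≤ n) {φ d b : L2 n}
    (hd : HasWeakRadialDeriv φ d) (hb : ∀ᵐ x : E n, b x = φ x / (‖x‖ : ℂ)) :
    ∃ (hr : φ ∈ (radialDeriv n).domain) (hA : φ ∈ (opA n).domain) (hB : φ ∈ (opB n).domain),
      radialDeriv n ⟨φ, hr⟩ = d ∧ opB n ⟨φ, hB⟩ = b ∧
        opA n ⟨φ, hA⟩ = -Complex.I • d + (-Complex.I * (((n : ℂ) - 1) / 2)) • b := by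
  obtain ⟨⟨_, hr⟩, h1, rfl⟩ := (LinearPMap.mem_graph_iff _).mp ((mem_graph_radialDeriv hn φ d).mpr hd)
  obtain ⟨⟨_, hB⟩, h2, rfl⟩ := (LinearPMap.mem_graph_iff _).mp ((mem_graph_opB φ b).mpr hb)
  simp only at h1 h2
  subst h1
  subst h2
  exact ⟨hr, ⟨hr, hB⟩, hB, rfl, rfl, rfl⟩

theorem IsTest.exists_domain {n : ℕ} (hn : 1 ≤ n) {f : E n → ℂ} (hf : IsTest f) {φ : L2 n}
    (hφ : φ =ᵐ[volume] f) :
    ∃ (hA : φ ∈ (opA n).domain) (hB : φ ∈ (opB n).domain),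
      opB n ⟨φ, hB⟩ =ᵐ[volume] (fun x => f x / (‖x‖ : ℂ)) ∧
      opA n ⟨φ, hA⟩ =ᵐ[volume] fun x => -Complex.I * RadialHardy.classicalRadial f x +
        (-Complex.I * (((n : ℂ) - 1) / 2)) * (f x / (‖x‖ : ℂ)) := by
  have hd : HasWeakRadialDeriv φ hf.classicalRadial.memLp.toLp :=
    hasWeakRadialDeriv_of_contDiff (hf.1.of_le (by norm_cast)) hφ
      hf.classicalRadial.memLp.coeFn_toLp
  have hb : ∀ᵐ x : E n, (hf.div_norm.memLp.toLp : L2 n) x = φ x / (‖x‖ : ℂ) := by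
    filter_upwards [hφ, hf.div_norm.memLp.coeFn_toLp] with x h1 h2
    rw [h1, h2]
  obtain ⟨_, hA, hB, _, h2, h3⟩ := exists_domain_of_hasWeakRadialDeriv hn hd hb
  refine ⟨hA, hB, h2 ▸ hf.div_norm.memLp.coeFn_toLp, ?_⟩
  rw [h3]
  filter_upwards [Lp.coeFn_add (-Complex.I • hf.classicalRadial.memLp.toLp)
      ((-Complex.I * (((n : ℂ) - 1) / 2)) • hf.div_norm.memLp.toLp),
    Lp.coeFn_smul (-Complex.I) hf.classicalRadial.memLp.toLp,
    Lp.coeFn_smul (-Complex.I * (((n : ℂ) - 1) / 2)) hf.div_norm.memLp.toLp,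
    hf.div_norm.memLp.coeFn_toLp, hf.classicalRadial.memLp.coeFn_toLp] with x e1 e2 e3 e4 e5
  rw [e1, Pi.add_apply, e2, e3, Pi.smul_apply, Pi.smul_apply, e4, e5, smul_eq_mul, smul_eq_mul]

/-- `Aφ` and `Bφ` are again represented by test functions, so `IsTest.exists_domain` applies to `φ`,
`Bφ` and `Aφ` in turn and leaves a pointwise identity off the origin. -/
theorem commutator_of_isTest {n : ℕ} (hn : 1 ≤ n) {f : E n → ℂ} (hf : IsTest f) {φ : L2 n}
    (hφ : φ =ᵐ[volume] f) :
    ∃ (hA : φ ∈ (opA n).domain) (hB : φ ∈ (opB n).domain)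
      (hAB : opB n ⟨φ, hB⟩ ∈ (opA n).domain) (hBA : opA n ⟨φ, hA⟩ ∈ (opB n).domain)
      (hBB : opB n ⟨φ, hB⟩ ∈ (opB n).domain),
      opA n ⟨opB n ⟨φ, hB⟩, hAB⟩ - opB n ⟨opA n ⟨φ, hA⟩, hBA⟩ =
        Complex.I • opB n ⟨opB n ⟨φ, hB⟩, hBB⟩ := by
  have : Nonempty (Fin n) := ⟨⟨0, hn⟩⟩
  obtain ⟨hA, hB, eB, eA⟩ := hf.exists_domain hn hφ
  obtain ⟨hAB, hBB, eBB, eAB⟩ := hf.div_norm.exists_domain hn eB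
  obtain ⟨-, hBA, eBA, -⟩ := (hf.classicalRadial.const_mul_add hf.div_norm (-Complex.I)
    (-Complex.I * (((n : ℂ) - 1) / 2))).exists_domain hn eA
  refine ⟨hA, hB, hAB, hBA, hBB, ?_⟩
  have hne : ∀ᵐ x ∂(volume : Measure (E n)), x ∈ ({0}ᶜ : Set (E n)) :=
    compl_mem_ae_iff.mpr (measure_singleton _)
  apply Lp.ext
  filter_upwards [Lp.coeFn_sub (opA n ⟨opB n ⟨φ, hB⟩, hAB⟩) (opB n ⟨opA n ⟨φ, hA⟩, hBA⟩),
    Lp.coeFn_smul Complex.I (opB n ⟨opB n ⟨φ, hB⟩, hBB⟩), eBB, eAB, eBA, hne]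
    with x e1 e2 e3 e4 e5 hx
  rw [e1, e2, Pi.sub_apply, Pi.smul_apply, e3, e4, e5, hf.classicalRadial_div_norm hx, smul_eq_mul]
  ring

/-! ### Hilbert space algebra -/

/-- The algebra behind the Hardy identities: all of them follow from the virial relation
`(N - 2)‖b‖² = -2 Re (b, d)` for `d = ∂ᵣφ`, `b = φ/|x|` and `a = -i d - i ((N - 1)/2) b`. -/
theorem hardy_identities {H : Type*} [NormedAddCommGroup H] [InnerProductSpace ℂ H] (N : ℝ)
    {a b d : H} (ha : a = -Complex.I • d + (-Complex.I * (((N : ℂ) - 1) / 2)) • b)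
    (h : (N - 2) * ‖b‖ ^ 2 = -2 * (inner ℂ b d : ℂ).re) :
    ‖b‖ ^ 2 = -2 * (sp a b).im ∧
    ‖a‖ ^ 2 = ‖d‖ ^ 2 - (N - 1) * (N - 3) / 4 * ‖b‖ ^ 2 ∧
    ‖b‖ ≤ 2 * ‖a‖ ∧
    ‖a‖ = ‖d + (((N : ℂ) - 1) / 2) • b‖ ∧
    4 * ‖d‖ ^ 2 = 4 * ‖d + (((N : ℂ) - 2) / 2) • b‖ ^ 2 + (N - 2) ^ 2 * ‖b‖ ^ 2 := by
  have ha' : a = -Complex.I • (d + (((N : ℂ) - 1) / 2) • b) := by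
    rw [ha, smul_add, smul_smul]
  have hna : ‖a‖ = ‖d + (((N : ℂ) - 1) / 2) • b‖ := by
    rw [ha', norm_smul]; simp
  have key (t : ℝ) : ‖d + ((t : ℝ) : ℂ) • b‖ ^ 2 =
      ‖d‖ ^ 2 + 2 * t * (inner ℂ b d : ℂ).re + t ^ 2 * ‖b‖ ^ 2 := by
    rw [@norm_add_sq ℂ, norm_smul, inner_smul_right]
    have hs : (inner ℂ d b : ℂ).re = (inner ℂ b d : ℂ).re := inner_re_symm (𝕜 := ℂ) d b
    simp [mul_pow, hs]
    ring
  have c1 : ((N : ℂ) - 1) / 2 = (((N - 1) / 2 : ℝ) : ℂ) := by push_cast; rfl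
  have c2 : ((N : ℂ) - 2) / 2 = (((N - 2) / 2 : ℝ) : ℂ) := by push_cast; rfl
  -- Expanding, `-2 Im (a|b) = 2 Re (b, d) + (N - 1)‖b‖²`; the virial relation leaves the
  -- coefficient `(N - 1) - (N - 2) = 1`.
  have him : ‖b‖ ^ 2 = -2 * (sp a b).im := by
    have hbb : (inner ℂ b b : ℂ) = ((‖b‖ ^ 2 : ℝ) : ℂ) := by
      rw [inner_self_eq_norm_sq_to_K]; push_cast; rfl
    rw [sp, ha', inner_smul_right, inner_add_right, inner_smul_right, c1, hbb]
    simp [-Complex.ofReal_pow, -Complex.ofReal_div, -Complex.ofReal_sub]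
    linarith
  refine ⟨him, ?_, ?_, hna, ?_⟩
  · rw [hna, c1, key]
    linear_combination ((N - 1) / 2) * h
  -- Cauchy–Schwarz in the identity just proved gives `‖b‖² ≤ 2‖a‖‖b‖`; one factor `‖b‖` is
  -- cancelled when it is nonzero.
  · by_cases hb : ‖b‖ = 0
    · rw [hb]; positivity
    · have h1 : |(sp a b).im| ≤ ‖b‖ * ‖a‖ :=
        (Complex.abs_im_le_norm _).trans (norm_inner_le_norm b a)
      have h2 : 0 < ‖b‖ := lt_of_le_of_ne (norm_nonneg b) (Ne.symm hb)
      have h3 := neg_abs_le (sp a b).im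
      nlinarith
  · rw [c2, key]
    linear_combination (-2 * (N - 2)) * h

/-- The two normalized vectors have norm one, so the square of the norm is `2 + 2 Im
(a|b)/(‖a‖‖b‖)`. No virial relation enters. -/
theorem norm_sub_sq_identity {H : Type*} [NormedAddCommGroup H] [InnerProductSpace ℂ H]
    {a b : H} (ha : a ≠ 0) (hb : b ≠ 0) :
    -2 * (sp a b).im = ‖a‖ * ‖b‖ *
      (2 - ‖((‖a‖⁻¹ : ℝ) : ℂ) • a + Complex.I • (((‖b‖⁻¹ : ℝ) : ℂ) • b)‖ ^ 2) := by
  have ha' : ‖a‖ ≠ 0 := norm_ne_zero_iff.mpr ha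
  have hb' : ‖b‖ ≠ 0 := norm_ne_zero_iff.mpr hb
  rw [@norm_add_sq ℂ, norm_smul, norm_smul, norm_smul, inner_smul_left, inner_smul_right,
    inner_smul_right, sp, ← inner_conj_symm a b]
  simp only [Complex.norm_real, norm_inv, norm_norm, Complex.norm_I, one_mul, inv_mul_cancel₀ ha',
    inv_mul_cancel₀ hb', Complex.conj_ofReal]
  simp only [RCLike.re_to_complex, Complex.re_ofReal_mul, Complex.I_mul_re, Complex.im_ofReal_mul,
    Complex.conj_im]
  field_simp
  ring

/-- With `z = (Aφ|Bφ)` the form on the diagonal is `conj z - z = -2i Im z`. -/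
theorem neg_I_mul_commForm {H : Type*} [NormedAddCommGroup H] [InnerProductSpace ℂ H]
    (A B : H →ₗ.[ℂ] H) (φ : (A.domain ⊓ B.domain : Submodule ℂ H)) :
    -Complex.I * commForm A B φ φ =
      ((-2 * (sp (A ⟨φ, φ.2.1⟩) (B ⟨φ, φ.2.2⟩)).im : ℝ) : ℂ) := by
  have hs := inner_conj_symm (𝕜 := ℂ) (A ⟨φ, φ.2.1⟩) (B ⟨φ, φ.2.2⟩)
  rw [commForm, sp, sp, ← hs]
  apply Complex.ext <;> simp [-inner_conj_symm]
  ring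

/-! ### The regularized field `x/(|x|² + ε)` and integration by parts -/

/-- The regularized inverse square weight `1 / (|x|² + ε)`. -/
def regWeight {n : ℕ} (ε : ℝ) (x : E n) : ℝ := (‖x‖ ^ 2 + ε)⁻¹

/-- The divergence of `x / (|x|² + ε)`. -/
def regDiv {n : ℕ} (ε : ℝ) (x : E n) : ℝ :=
  n * regWeight ε x - 2 * ‖x‖ ^ 2 * regWeight ε x ^ 2

variable {n : ℕ} {ε : ℝ}

theorem regWeight_pos (hε : 0 < ε) (x : E n) : 0 < regWeight ε x := by
  unfold regWeight; positivity

theorem regWeight_le (hε : 0 < ε) (x : E n) : regWeight ε x ≤ ε⁻¹ := by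
  unfold regWeight; gcongr; nlinarith [sq_nonneg ‖x‖]

theorem sq_mul_regWeight_le (hε : 0 < ε) (x : E n) : ‖x‖ ^ 2 * regWeight ε x ≤ 1 := by
  rw [regWeight, ← div_eq_mul_inv]
  exact div_le_one_of_le₀ (by linarith) (by positivity)

/-- A crude bound: only boundedness for fixed `ε` is needed. The uniform estimates rest on
`sq_mul_regWeight_le`. -/
theorem norm_mul_regWeight_le (hε : 0 < ε) (x : E n) : ‖x‖ * regWeight ε x ≤ 1 + ε⁻¹ := by
  have h1 := sq_mul_regWeight_le hε x
  have h2 := regWeight_le hε x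
  have h3 := regWeight_pos hε x
  have h4 : ‖x‖ ≤ ‖x‖ ^ 2 + 1 := by nlinarith [sq_nonneg (‖x‖ - 1)]
  calc ‖x‖ * regWeight ε x ≤ (‖x‖ ^ 2 + 1) * regWeight ε x := by gcongr
    _ ≤ 1 + ε⁻¹ := by linarith

theorem regWeight_contDiff (hε : 0 < ε) : ContDiff ℝ 1 (regWeight ε : E n → ℝ) :=
  ((contDiff_norm_sq ℝ).add contDiff_const).inv fun x => by positivity

theorem regWeight_continuous (hε : 0 < ε) : Continuous (regWeight ε : E n → ℝ) :=
  (regWeight_contDiff hε).continuous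

theorem regDiv_continuous (hε : 0 < ε) : Continuous (regDiv ε : E n → ℝ) := by
  have := regWeight_continuous (n := n) hε
  unfold regDiv
  fun_prop

/-- Multiplied by `|x|²`, the right side is at most `n + 2` for every `ε`; this is the domination
used as `ε → 0`. -/
theorem abs_regDiv_le (hε : 0 < ε) (x : E n) : |regDiv ε x| ≤ (n + 2) * regWeight ε x := by
  have h1 := sq_mul_regWeight_le hε x
  have h3 := regWeight_pos hε x
  have h4 : 0 ≤ ‖x‖ ^ 2 * regWeight ε x ^ 2 := by positivity
  have h5 : ‖x‖ ^ 2 * regWeight ε x ^ 2 ≤ regWeight ε x := by nlinarith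
  have h6 : 0 ≤ n * regWeight ε x := by positivity
  rw [regDiv, abs_le]
  constructor <;> nlinarith

theorem fderiv_coord_mul_regWeight (hε : 0 < ε) (j : Fin n) (x : E n) :
    fderiv ℝ (fun y : E n => y j * regWeight ε y) x (EuclideanSpace.single j 1) =
      regWeight ε x - 2 * x j ^ 2 * regWeight ε x ^ 2 := by
  have h1 : HasFDerivAt (fun y : E n => y j) (EuclideanSpace.proj j : E n →L[ℝ] ℝ) x :=
    (EuclideanSpace.proj j : E n →L[ℝ] ℝ).hasFDerivAt
  have h2 : HasFDerivAt (fun y : E n => ‖y‖ ^ 2 + ε) (2 • innerSL ℝ x) x :=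
    (hasStrictFDerivAt_norm_sq x).hasFDerivAt.add_const ε
  have h0 : ‖x‖ ^ 2 + ε ≠ 0 := by positivity
  have h3 : HasFDerivAt (regWeight ε : E n → ℝ) (-((‖x‖ ^ 2 + ε) ^ 2)⁻¹ • (2 • innerSL ℝ x)) x :=
    (hasDerivAt_inv h0).comp_hasFDerivAt x h2
  have h4 : HasFDerivAt (fun y : E n => y j * regWeight ε y) _ x := h1.mul h3
  rw [h4.fderiv]
  simp [regWeight, EuclideanSpace.inner_single_right]
  ring

theorem regDiv_eq_sum (hε : 0 < ε) (x : E n) :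
    ∑ j, fderiv ℝ (fun y : E n => y j * regWeight ε y) x (EuclideanSpace.single j 1) =
      regDiv ε x := by
  simp only [fderiv_coord_mul_regWeight hε]
  rw [Finset.sum_sub_distrib, ← Finset.sum_mul, ← Finset.mul_sum, regDiv,
    EuclideanSpace.real_norm_sq_eq]
  simp

theorem fderiv_normSq (u : 𝓢(E n, ℂ)) (x v : E n) :
    fderiv ℝ (fun y => ‖u y‖ ^ 2) x v = 2 * inner ℝ (u x) (fderiv ℝ u x v) := by
  rw [(u.differentiableAt.hasFDerivAt (x := x)).norm_sq.fderiv]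
  simp only [smul_apply, ContinuousLinearMap.comp_apply, innerSL_apply_apply, nsmul_eq_mul,
    Nat.cast_ofNat]

/-- Integration by parts against the vector field `x / (|x|² + ε)` for Schwartz functions. -/
theorem integral_regDiv_schwartz (hε : 0 < ε) (u : 𝓢(E n, ℂ)) :
    ∫ x, regDiv ε x * ‖u x‖ ^ 2 =
      -2 * ∫ x, ‖x‖ * regWeight ε x * inner ℝ (u x) (classicalRadial u x) := by
  set e : Fin n → E n := fun j => EuclideanSpace.single j 1
  have iq : Integrable fun x => ‖u x‖ ^ 2 := (u.memLp 2).integrable_norm_pow (by norm_num)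
  have hcd (j : Fin n) : Continuous fun x => fderiv ℝ u x (e j) :=
    ((u.smooth 1).continuous_fderiv one_ne_zero).clm_apply continuous_const
  have id (j : Fin n) : Integrable fun x => fderiv ℝ (fun y => ‖u y‖ ^ 2) x (e j) := by
    simp only [fderiv_normSq]
    have i2 : Integrable fun x => ‖fderiv ℝ u x (e j)‖ ^ 2 := by
      simpa only [SchwartzMap.lineDerivOp_apply_eq_fderiv] using
        ((∂_{e j} u).memLp 2 volume).integrable_norm_pow (by norm_num)
    refine (iq.add i2).mono'
      ((continuous_const.mul (u.continuous.inner (hcd j))).aestronglyMeasurable)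
      (.of_forall fun x => ?_)
    have h1 := abs_real_inner_le_norm (u x) (fderiv ℝ u x (e j))
    rw [norm_mul, Real.norm_eq_abs, Real.norm_eq_abs, abs_two, Pi.add_apply]
    nlinarith [sq_nonneg (‖u x‖ - ‖fderiv ℝ u x (e j)‖)]
  have hcV (j : Fin n) : ContDiff ℝ 1 fun y : E n => y j * regWeight ε y :=
    (by fun_prop : ContDiff ℝ 1 fun y : E n => y j).mul (regWeight_contDiff hε)
  have bV (j : Fin n) (x : E n) : ‖x j * regWeight ε x‖ ≤ 1 + ε⁻¹ := by
    rw [norm_mul, Real.norm_of_nonneg (regWeight_pos hε x).le]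
    refine le_trans ?_ (norm_mul_regWeight_le hε x)
    have := (regWeight_pos hε x).le
    gcongr
    exact PiLp.norm_apply_le x j
  have bdV (j : Fin n) (x : E n) :
      ‖fderiv ℝ (fun y : E n => y j * regWeight ε y) x (e j)‖ ≤ 3 * ε⁻¹ := by
    rw [fderiv_coord_mul_regWeight hε]
    have h1 := sq_mul_regWeight_le hε x
    have h2 := regWeight_le hε x
    have h3 := regWeight_pos hε x
    have h4 : x j ^ 2 ≤ ‖x‖ ^ 2 := by
      rw [sq_le_sq, abs_norm]
      exact PiLp.norm_apply_le x j
    have h5 : x j ^ 2 * regWeight ε x ^ 2 ≤ regWeight ε x := by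
      calc x j ^ 2 * regWeight ε x ^ 2 ≤ ‖x‖ ^ 2 * regWeight ε x ^ 2 := by gcongr
        _ ≤ regWeight ε x := by nlinarith
    have h6 : 0 ≤ x j ^ 2 * regWeight ε x ^ 2 := by positivity
    rw [Real.norm_eq_abs, abs_le]
    constructor <;> nlinarith
  have i1 (j : Fin n) : Integrable fun x =>
      fderiv ℝ (fun y : E n => y j * regWeight ε y) x (e j) * ‖u x‖ ^ 2 :=
    iq.bdd_mul (((hcV j).continuous_fderiv one_ne_zero).clm_apply
      continuous_const).aestronglyMeasurable (.of_forall (bdV j))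
  have i2 (j : Fin n) : Integrable fun x =>
      x j * regWeight ε x * fderiv ℝ (fun y => ‖u y‖ ^ 2) x (e j) :=
    (id j).bdd_mul (hcV j).continuous.aestronglyMeasurable (.of_forall (bV j))
  have i3 (j : Fin n) : Integrable fun x => x j * regWeight ε x * ‖u x‖ ^ 2 :=
    iq.bdd_mul (hcV j).continuous.aestronglyMeasurable (.of_forall (bV j))
  have parts (j : Fin n) := integral_mul_fderiv_eq_neg_fderiv_mul_of_integrable (i1 j) (i2 j) (i3 j)
    (fun x _ => (hcV j).differentiable one_ne_zero x)
    (fun x _ => (u.differentiableAt.norm_sq ℝ))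
  have eL : (fun x => regDiv ε x * ‖u x‖ ^ 2) = fun x =>
      ∑ j, fderiv ℝ (fun y : E n => y j * regWeight ε y) x (e j) * ‖u x‖ ^ 2 := by
    ext x
    rw [← regDiv_eq_sum hε, Finset.sum_mul]
  have eR : (fun x => 2 * (‖x‖ * regWeight ε x * inner ℝ (u x) (classicalRadial u x))) = fun x =>
      ∑ j, x j * regWeight ε x * fderiv ℝ (fun y => ‖u y‖ ^ 2) x (e j) := by
    ext x
    rw [classicalRadial_eq_sum, inner_sum, Finset.mul_sum, Finset.mul_sum]
    refine Finset.sum_congr rfl fun j _ => ?_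
    rw [fderiv_normSq, inner_smul_right]
    -- The factor `|x|` cancels the denominator in `xⱼ/|x|`; at the origin both sides vanish.
    by_cases hx : x = 0
    · simp [hx]
    · have : ‖x‖ ≠ 0 := norm_ne_zero_iff.mpr hx
      field_simp
      rfl
  rw [neg_mul, ← integral_const_mul, eL, eR, integral_finsetSum _ fun j _ => i1 j,
    integral_finsetSum _ fun j _ => i2 j, ← Finset.sum_neg_distrib]
  exact Finset.sum_congr rfl fun j _ => by rw [parts j, neg_neg]

/-! ### Extension of the regularized identity to `H¹` -/

theorem re_inner_eq_integral (f g : L2 n) :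
    (inner ℂ f g : ℂ).re = ∫ x, inner ℝ (f x) (g x) := by
  rw [L2.inner_def]
  exact (integral_re (𝕜 := ℂ) (L2.integrable_inner f g)).symm

theorem norm_sq_eq_integral (f : L2 n) : ‖f‖ ^ 2 = ∫ x, ‖f x‖ ^ 2 := by
  have h := re_inner_eq_integral f f
  simp only [real_inner_self_eq_norm_sq] at h
  rw [← h]
  exact (inner_self_eq_norm_sq (𝕜 := ℂ) f).symm

/-- Weighted integrals become inner products with bounded operators, hence continuous in both `L²`
arguments, so identities between them survive closure. -/
theorem re_inner_mulL {m : E n → ℝ} (hm : MemLp (fun x => (m x : ℂ)) ⊤ volume) (f g : L2 n) :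
    (inner ℂ f (mulL hm.toLp g) : ℂ).re = ∫ x, m x * inner ℝ (f x) (g x) := by
  rw [re_inner_eq_integral]
  refine integral_congr_ae ?_
  filter_upwards [mulL_toLp_ae hm g] with x hx
  rw [hx, ← Complex.real_smul, inner_smul_right]

theorem memLp_regDiv (hε : 0 < ε) : MemLp (fun x : E n => (regDiv ε x : ℂ)) ⊤ volume := by
  refine memLp_top_of_bound
    (Complex.continuous_ofReal.comp (regDiv_continuous hε)).aestronglyMeasurable
    ((n + 2) * ε⁻¹) (.of_forall fun x => ?_)
  rw [Complex.norm_real, Real.norm_eq_abs]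
  refine (abs_regDiv_le hε x).trans ?_
  have := regWeight_le hε x
  gcongr

theorem memLp_norm_mul_regWeight (hε : 0 < ε) :
    MemLp (fun x : E n => ((‖x‖ * regWeight ε x : ℝ) : ℂ)) ⊤ volume := by
  refine memLp_top_of_bound
    (Complex.continuous_ofReal.comp
      (continuous_norm.mul (regWeight_continuous hε))).aestronglyMeasurable
    (1 + ε⁻¹) (.of_forall fun x => ?_)
  rw [Complex.norm_real, Real.norm_of_nonneg
    (mul_nonneg (norm_nonneg x) (regWeight_pos hε x).le)]
  exact norm_mul_regWeight_le hε x

theorem integral_regDiv_of_mem_closure (hε : 0 < ε) {φ d : L2 n}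
    (h : (φ, d) ∈ closure (schwartzRadialGraph n)) :
    ∫ x, regDiv ε x * ‖φ x‖ ^ 2 = -2 * ∫ x, ‖x‖ * regWeight ε x * inner ℝ (φ x) (d x) := by
  have hc : IsClosed {p : L2 n × L2 n |
      (inner ℂ p.1 (mulL (memLp_regDiv hε).toLp p.1) : ℂ).re =
        -2 * (inner ℂ p.1 (mulL (memLp_norm_mul_regWeight hε).toLp p.2) : ℂ).re} :=
    isClosed_eq (by fun_prop) (by fun_prop)
  have key := closure_minimal (t := _) ?_ hc h
  · simpa only [Set.mem_ofPred_eq, re_inner_mulL, real_inner_self_eq_norm_sq] using key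
  · rintro ⟨f, g⟩ ⟨u, h1, h2⟩
    simp only [Set.mem_ofPred_eq, re_inner_mulL, real_inner_self_eq_norm_sq]
    rw [integral_congr_ae (g := fun x => regDiv ε x * ‖u x‖ ^ 2)
        (by filter_upwards [h1] with x h1 using by rw [h1]),
      integral_congr_ae (f := fun x => ‖x‖ * regWeight ε x * inner ℝ (f x) (g x))
        (g := fun x => ‖x‖ * regWeight ε x * inner ℝ (u x) (classicalRadial u x))
        (by filter_upwards [h1, h2] with x h1 h2 using by rw [h1, h2])]
    exact integral_regDiv_schwartz hε u

/-- With `w = regWeight ε` and `f = |x|wφ`: since `|x|²w ≤ 1` and `n ≥ 3`, the divergence `nw -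
2|x|²w²` dominates `|x|²w²`. Hence `‖f‖² ≤ -2 Re (f, d) ≤ 2‖f‖‖d‖`, uniformly in `ε`. -/
theorem norm_mulL_regWeight_le (hn : 3 ≤ n) (hε : 0 < ε) {φ d : L2 n}
    (h : (φ, d) ∈ closure (schwartzRadialGraph n)) :
    ‖mulL (memLp_norm_mul_regWeight hε).toLp φ‖ ≤ 2 * ‖d‖ := by
  set f := mulL (memLp_norm_mul_regWeight hε).toLp φ with hf
  have hfe := mulL_toLp_ae (memLp_norm_mul_regWeight hε) φ
  have hn' : (3 : ℝ) ≤ n := by exact_mod_cast hn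
  have h1 : ‖f‖ ^ 2 ≤ ∫ x, regDiv ε x * ‖φ x‖ ^ 2 := by
    rw [norm_sq_eq_integral]
    have iφ : Integrable fun x => ‖φ x‖ ^ 2 := (Lp.memLp φ).integrable_norm_pow (by norm_num)
    refine integral_mono_ae ((Lp.memLp f).integrable_norm_pow (by norm_num))
      (iφ.bdd_mul (regDiv_continuous hε).aestronglyMeasurable
        (c := (n + 2) * ε⁻¹) (.of_forall fun x => ?_)) ?_
    · refine (abs_regDiv_le hε x).trans ?_
      have := regWeight_le hε x
      gcongr
    · filter_upwards [hfe] with x hx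
      rw [hx, norm_mul, Complex.norm_real, Real.norm_of_nonneg
        (mul_nonneg (norm_nonneg x) (regWeight_pos hε x).le), mul_pow]
      gcongr
      have h1 := sq_mul_regWeight_le hε x
      have h3 := regWeight_pos hε x
      have h4 : ‖x‖ ^ 2 * regWeight ε x ^ 2 ≤ regWeight ε x := by nlinarith
      rw [mul_pow, regDiv]
      nlinarith
  have h2 : ∫ x, ‖x‖ * regWeight ε x * inner ℝ (φ x) (d x) = (inner ℂ f d : ℂ).re := by
    rw [re_inner_eq_integral]
    refine integral_congr_ae ?_
    filter_upwards [hfe] with x hx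
    rw [hx, ← Complex.real_smul, real_inner_smul_left]
  rw [integral_regDiv_of_mem_closure hε h, h2] at h1
  have h3 : |(inner ℂ f d : ℂ).re| ≤ ‖f‖ * ‖d‖ :=
    (Complex.abs_re_le_norm _).trans (norm_inner_le_norm f d)
  have h4 := neg_abs_le (inner ℂ f d : ℂ).re
  by_contra! h5
  have h6 := norm_nonneg d
  nlinarith

/-! ### Removal of the regularization -/

/-- The regularization parameters `1 / (k + 1)`. -/
def regParam (k : ℕ) : ℝ := 1 / ((k : ℝ) + 1)

theorem regParam_pos (k : ℕ) : 0 < regParam k := Nat.one_div_pos_of_nat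

theorem tendsto_regWeight {x : E n} (hx : x ≠ 0) :
    Filter.Tendsto (fun k => regWeight (regParam k) x) Filter.atTop (𝓝 (‖x‖ ^ 2)⁻¹) := by
  have hx' : ‖x‖ ^ 2 ≠ 0 := pow_ne_zero 2 (norm_ne_zero_iff.mpr hx)
  have h := (tendsto_one_div_add_atTop_nhds_zero_nat (𝕜 := ℝ)).const_add (‖x‖ ^ 2)
  rw [add_zero] at h
  exact h.inv₀ hx'

theorem ae_ne_zero (hn : 1 ≤ n) : ∀ᵐ x ∂(volume : Measure (E n)), x ≠ 0 := by
  have : Nonempty (Fin n) := ⟨⟨0, hn⟩⟩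
  exact compl_mem_ae_iff.mpr (measure_singleton _)

/-- Fatou's lemma: the functions `|x|φ/(|x|² + ε)` are bounded in `L²` by `2‖d‖` and tend to `φ/|x|`
off the origin. -/
theorem memLp_div_norm_of_mem_closure (hn : 3 ≤ n) {φ d : L2 n}
    (h : (φ, d) ∈ closure (schwartzRadialGraph n)) :
    MemLp (fun x => φ x / (‖x‖ : ℂ)) 2 volume := by
  have hm : AEStronglyMeasurable (fun x => φ x / (‖x‖ : ℂ)) volume :=
    ((Lp.stronglyMeasurable φ).measurable.div
      (Complex.measurable_ofReal.comp measurable_norm)).aestronglyMeasurable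
  refine ⟨hm, lt_of_le_of_lt (Lp.eLpNorm_le_of_ae_tendsto (u := Filter.atTop)
    (f := fun k => mulL (memLp_norm_mul_regWeight (regParam_pos k)).toLp φ)
    (C := (2 * ‖d‖).toNNReal) (.of_forall fun k => ?_) (fun k => Lp.aestronglyMeasurable _) ?_)
    ENNReal.coe_lt_top⟩
  · rw [← Lp.enorm_def, ← ofReal_norm]
    exact ENNReal.ofReal_le_ofReal (norm_mulL_regWeight_le hn (regParam_pos k) h)
  · have h1 : ∀ᵐ x ∂(volume : Measure (E n)), ∀ k,
        mulL (memLp_norm_mul_regWeight (regParam_pos k)).toLp φ x =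
          ((‖x‖ * regWeight (regParam k) x : ℝ) : ℂ) * φ x :=
      ae_all_iff.mpr fun k => mulL_toLp_ae (memLp_norm_mul_regWeight (regParam_pos k)) φ
    filter_upwards [h1, ae_ne_zero (by omega : 1 ≤ n)] with x h1 hx
    simp only [h1]
    have hx' : (‖x‖ : ℂ) ≠ 0 := by exact_mod_cast norm_ne_zero_iff.mpr hx
    have e : φ x / (‖x‖ : ℂ) = ((‖x‖ * (‖x‖ ^ 2)⁻¹ : ℝ) : ℂ) * φ x := by
      push_cast
      field_simp
    rw [e]
    exact ((Complex.continuous_ofReal.tendsto _).comp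
      ((tendsto_regWeight hx).const_mul ‖x‖)).mul_const _

/-- The virial relation `(n - 2)‖φ/|x|‖² = -2 Re (φ/|x|, ∂ᵣφ)`. -/
theorem virial_of_mem_closure (hn : 1 ≤ n) {φ d b : L2 n}
    (h : (φ, d) ∈ closure (schwartzRadialGraph n)) (hb : ∀ᵐ x : E n, b x = φ x / (‖x‖ : ℂ)) :
    ((n : ℝ) - 2) * ‖b‖ ^ 2 = -2 * (inner ℂ b d : ℂ).re := by
  have iφ : Integrable fun x => ‖φ x‖ ^ 2 := (Lp.memLp φ).integrable_norm_pow (by norm_num)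
  have ib : Integrable fun x => ‖b x‖ ^ 2 := (Lp.memLp b).integrable_norm_pow (by norm_num)
  have idd : Integrable fun x => ‖d x‖ ^ 2 := (Lp.memLp d).integrable_norm_pow (by norm_num)
  have hφb : ∀ᵐ x : E n, x ≠ 0 ∧ φ x = ‖x‖ • b x := by
    filter_upwards [hb, ae_ne_zero hn] with x h1 h2
    have hx' : (‖x‖ : ℂ) ≠ 0 := by exact_mod_cast norm_ne_zero_iff.mpr h2
    rw [h1, Complex.real_smul]
    exact ⟨h2, by field_simp⟩
  have t1 : Filter.Tendsto (fun k => ∫ x, regDiv (regParam k) x * ‖φ x‖ ^ 2) Filter.atTop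
      (𝓝 (∫ x, ((n : ℝ) - 2) * ‖b x‖ ^ 2)) := by
    -- Writing `φ = |x|b` supplies the factor `|x|²` that makes the divergence bounded by `n + 2`.
    -- Its pointwise limit is `n/|x|² - 2|x|²/|x|⁴ = (n - 2)/|x|²`.
    refine tendsto_integral_of_dominated_convergence (fun x => ((n : ℝ) + 2) * ‖b x‖ ^ 2)
      (fun k => (regDiv_continuous (regParam_pos k)).aestronglyMeasurable.mul iφ.1)
      (ib.const_mul _) (fun k => ?_) ?_
    · filter_upwards [hφb] with x hx
      rw [hx.2, norm_smul, norm_norm, norm_mul, mul_pow, Real.norm_eq_abs,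
        Real.norm_of_nonneg (by positivity), ← mul_assoc]
      gcongr
      calc |regDiv (regParam k) x| * ‖x‖ ^ 2
          ≤ ((n : ℝ) + 2) * regWeight (regParam k) x * ‖x‖ ^ 2 := by
            gcongr
            exact abs_regDiv_le (regParam_pos k) x
        _ = ((n : ℝ) + 2) * (‖x‖ ^ 2 * regWeight (regParam k) x) := by ring
        _ ≤ ((n : ℝ) + 2) * 1 := by
            gcongr
            exact sq_mul_regWeight_le (regParam_pos k) x
        _ = (n : ℝ) + 2 := mul_one _
    · filter_upwards [hφb] with x hx
      have hx' : ‖x‖ ≠ 0 := norm_ne_zero_iff.mpr hx.1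
      have hw := tendsto_regWeight hx.1
      have := ((hw.const_mul (n : ℝ)).sub ((hw.pow 2).const_mul (2 * ‖x‖ ^ 2))).mul_const
        (‖φ x‖ ^ 2)
      have e : ((n : ℝ) - 2) * ‖b x‖ ^ 2 =
          (n * (‖x‖ ^ 2)⁻¹ - 2 * ‖x‖ ^ 2 * (‖x‖ ^ 2)⁻¹ ^ 2) * ‖φ x‖ ^ 2 := by
        rw [hx.2, norm_smul, norm_norm]
        field_simp
      rw [e]
      exact this
  have t2 : Filter.Tendsto
      (fun k => ∫ x, ‖x‖ * regWeight (regParam k) x * inner ℝ (φ x) (d x)) Filter.atTop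
      (𝓝 (∫ x, inner ℝ (b x) (d x))) := by
    -- Here too `φ = |x|b` turns the weight into `|x|²/(|x|² + ε) ≤ 1`.
    refine tendsto_integral_of_dominated_convergence (fun x => ‖b x‖ ^ 2 + ‖d x‖ ^ 2)
      (fun k => ((continuous_norm.mul
        (regWeight_continuous (regParam_pos k))).aestronglyMeasurable).mul
          ((Lp.aestronglyMeasurable φ).inner (Lp.aestronglyMeasurable d)))
      (ib.add idd) (fun k => ?_) ?_
    · filter_upwards [hφb] with x hx
      have hw := (regWeight_pos (regParam_pos k) x).le
      rw [hx.2, real_inner_smul_left]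
      calc ‖‖x‖ * regWeight (regParam k) x * (‖x‖ * inner ℝ (b x) (d x))‖
          = (‖x‖ ^ 2 * regWeight (regParam k) x) * |inner ℝ (b x) (d x)| := by
            rw [← mul_assoc, norm_mul, Real.norm_of_nonneg (by positivity), Real.norm_eq_abs]
            ring
        _ ≤ 1 * (‖b x‖ * ‖d x‖) := by
            gcongr
            · exact sq_mul_regWeight_le (regParam_pos k) x
            · exact abs_real_inner_le_norm _ _
        _ ≤ ‖b x‖ ^ 2 + ‖d x‖ ^ 2 := by nlinarith [sq_nonneg (‖b x‖ - ‖d x‖)]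
    · filter_upwards [hφb] with x hx
      have hx' : ‖x‖ ≠ 0 := norm_ne_zero_iff.mpr hx.1
      have := ((tendsto_regWeight hx.1).const_mul ‖x‖).mul_const (inner ℝ (φ x) (d x))
      convert this using 2
      rw [hx.2, real_inner_smul_left]
      field_simp
  have e : (fun k => ∫ x, regDiv (regParam k) x * ‖φ x‖ ^ 2) = fun k =>
      -2 * ∫ x, ‖x‖ * regWeight (regParam k) x * inner ℝ (φ x) (d x) :=
    funext fun k => integral_regDiv_of_mem_closure (regParam_pos k) h
  rw [e] at t1
  rw [norm_sq_eq_integral, re_inner_eq_integral, ← integral_const_mul]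
  exact tendsto_nhds_unique t1 (t2.const_mul (-2))

end RadialHardy

end

theorem theorem3p5 (n : ℕ) (hn : 3 ≤ n) :
    -- the commutation relation `AB - BA = i B²` on `C₀^∞(ℝⁿ ∖ {0})`
    (∀ φ : RadialHardy.L2 n, (∃ f : RadialHardy.E n → ℂ, RadialHardy.IsTest f ∧ φ =ᵐ[MeasureTheory.volume] f) →
      ∃ (hA : φ ∈ (RadialHardy.opA n).domain) (hB : φ ∈ (RadialHardy.opB n).domain)
        (hAB : RadialHardy.opB n ⟨φ, hB⟩ ∈ (RadialHardy.opA n).domain)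
        (hBA : RadialHardy.opA n ⟨φ, hA⟩ ∈ (RadialHardy.opB n).domain)
        (hBB : RadialHardy.opB n ⟨φ, hB⟩ ∈ (RadialHardy.opB n).domain),
        RadialHardy.opA n ⟨RadialHardy.opB n ⟨φ, hB⟩, hAB⟩
            - RadialHardy.opB n ⟨RadialHardy.opA n ⟨φ, hA⟩, hBA⟩
          = Complex.I • RadialHardy.opB n ⟨RadialHardy.opB n ⟨φ, hB⟩, hBB⟩) ∧
    ∀ φ : RadialHardy.L2 n, φ ∈ RadialHardy.H1 n →
      ∃ (hr : φ ∈ (RadialHardy.radialDeriv n).domain) (hA : φ ∈ (RadialHardy.opA n).domain)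
        (hB : φ ∈ (RadialHardy.opB n).domain),
        let dr : RadialHardy.L2 n := RadialHardy.radialDeriv n ⟨φ, hr⟩
        let a : RadialHardy.L2 n := RadialHardy.opA n ⟨φ, hA⟩
        let b : RadialHardy.L2 n := RadialHardy.opB n ⟨φ, hB⟩
        (a ≠ 0 → b ≠ 0 →
          ((‖b‖ ^ 2 : ℝ) : ℂ) = -Complex.I *
            RadialHardy.commForm (RadialHardy.opA n) (RadialHardy.opB n)
              ⟨φ, hA, hB⟩ ⟨φ, hA, hB⟩ ∧
          ‖b‖ ^ 2 = -2 * (RadialHardy.sp a b).im ∧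
          ‖b‖ ^ 2 = ‖a‖ * ‖b‖ *
            (2 - ‖((‖a‖⁻¹ : ℝ) : ℂ) • a + Complex.I • (((‖b‖⁻¹ : ℝ) : ℂ) • b)‖ ^ 2) ∧
          ‖a‖ ^ 2 = ‖dr‖ ^ 2 - ((n : ℝ) - 1) * ((n : ℝ) - 3) / 4 * ‖b‖ ^ 2) ∧
        -- the consequences, for every `φ ∈ H¹`
        ‖b‖ ≤ 2 * ‖a‖ ∧
        ‖a‖ = ‖dr + (((n : ℂ) - 1) / 2) • b‖ ∧
        4 * ‖dr‖ ^ 2 = 4 * ‖dr + (((n : ℂ) - 2) / 2) • b‖ ^ 2 + ((n : ℝ) - 2) ^ 2 * ‖b‖ ^ 2 := by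
  refine ⟨fun φ ⟨f, hf, hφ⟩ => RadialHardy.commutator_of_isTest (by omega) hf hφ, fun φ hφ => ?_⟩
  obtain ⟨d, hd⟩ := RadialHardy.exists_mem_closure_schwartzRadialGraph hφ
  have hb := (RadialHardy.memLp_div_norm_of_mem_closure hn hd).coeFn_toLp
  set b : RadialHardy.L2 n := (RadialHardy.memLp_div_norm_of_mem_closure hn hd).toLp
  -- The limit `d` of the Schwartz radial derivatives is identified with `∂ᵣφ`, so the virial
  -- relation for `d` becomes one for the operators.
  obtain ⟨hr, hA, hB, rfl, e2, e3⟩ := RadialHardy.exists_domain_of_hasWeakRadialDeriv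
    (by omega) (RadialHardy.hasWeakRadialDeriv_of_mem_closure hd) hb
  have hv := RadialHardy.virial_of_mem_closure (by omega) hd hb
  rw [← e2] at e3 hv
  obtain ⟨h1, h2, h3, h4, h5⟩ := RadialHardy.hardy_identities (n : ℝ) e3 hv
  refine ⟨hr, hA, hB, fun ha hb => ⟨?_, h1, ?_, h2⟩, h3, h4, h5⟩
  · rw [RadialHardy.neg_I_mul_commForm, h1]
  · rw [← RadialHardy.norm_sub_sq_identity ha hb, h1]
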